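/- For a real number $\alpha$ and $n\ge 1$ put $P_n(\alpha)=\prod_{r=1}^{n}|2\sin \pi r\alpha|$. For an irrational $\alpha\in(0,1)$ write $\alpha=[0;a_1,a_2,\dots]$ for its (infinite) regular continued fraction expansion, with positive integer coefficients $a_j$. (i) There is a natural number $M_0$ such that for every integer $M\ge M_0$ there is a threshold $K=K(M)\in\{1,\dots,M\}$ with the following property: for every irrational $\alpha=[0;a_1,a_2,\dots]\in(0,1)$ with bounded continued fraction coefficients and $\max_{j\ge 1}a_j=M$, if $a_j\ge K$ for infinitely many $j$, then $$\liminf_{n\to\infty}P_n(\alpha)=0 .$$ (ii) More explicitly, whenever $1\le K\le M$ are integers with $$802+\frac{151\log M}{K}-\log K<0,$$ then $\liminf_{n\to\infty}P_n(\alpha)=0$ for every irrational $\alpha=[0;a_1,a_2,\dots]\in(0,1)$ with $\max_{j\ge1}a_j=M$ and $a_j\ge K$ for infinitely many $j$. -/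

import Mathlib

/-- The trigonometric (Sudler) product `P_n(α) = ∏_{r=1}^n |2 sin (π r α)|`. -/
noncomputable def sudlerProduct (n : ℕ) (α : ℝ) : ℝ :=
  ∏ r ∈ Finset.Icc 1 n, |2 * Real.sin (Real.pi * r * α)|

/-- `α = [0; a₁, a₂, a₃, …]`: the regular continued fraction of `α` is infinite, has integer part
`0`, and its `j`-th partial quotient is `a j` for every `j ≥ 1` (Mathlib numbers the partial
denominators from `0`). The value `a 0` plays no role. -/
structure HasContFracCoeffs (α : ℝ) (a : ℕ → ℕ) : Prop where
  intPart : (GenContFract.of α).h = 0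
  coeff : ∀ j : ℕ, (GenContFract.of α).partDens.get? j = some (a (j + 1) : ℝ)

/-! Let L be the upper limit of the coefficients, so L ≥ K ≥ e^802. Infinitely many convergents
satisfy |α - p/q| ≤ 1/(L q²), while ‖mα‖ ≥ 1/((L+2)m) for all large m. The claim is that P_q(α) ≤
1/2 at such q once q is large.

The last factor of P_q is at most 8/(Lq). For the others, log sin is concave, so comparing α with
p/q gives P_{q-1}(α) ≤ q exp(π(α - p/q) Σ r cot(πrp/q)), the product at p/q being exactly q. With p'
inverse to p modulo q, the cotangent sum is q Σ ({kp'/q} - 1/2) cot(πk/q). Summation by parts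
reduces it to sawtooth sums, which are O(B log k) if p'/q is badly approximable with constant B. For
bounded k one may take B = 2(L+2); for larger k a cruder constant suffices, because Σ log k / k² has
a small tail. The exponent is then bounded by an absolute constant (`abs_sum_mul_cot_le`,
`exists_forall_sudlerProduct_le_half`).

Finally P_{n+q} is close to P_q P_n when ‖qα‖ is small, so small values multiply and the lower limit
is 0. Working with L instead of M makes the threshold independent of M. -/

namespace GenContFract

/-! ### Convergents as reduced fractions and their exact quality. -/

open GenContFract (of)

/-- The auxiliary continuants of the continued fraction of a real number are integers. -/
theorem exists_int_contsAux (v : ℝ) (n : ℕ) :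
    ∃ A B : ℤ, (of v).contsAux n = ⟨(A : ℝ), (B : ℝ)⟩ := by
  induction n using Nat.strong_induction_on with
  | _ n ih =>
    match n with
    | 0 => exact ⟨1, 0, by simp [contsAux]⟩
    | 1 => exact ⟨⌊v⌋, 1, by simp [contsAux, of_h_eq_floor]⟩
    | n + 2 =>
      obtain ⟨A, B, h⟩ := ih n (by omega)
      obtain ⟨A', B', h'⟩ := ih (n + 1) (by omega)
      rcases hs : (of v).s.get? n with _ | gp
      · exact ⟨A', B', by rw [contsAux_stable_step_of_terminated hs, h']⟩
      · obtain ⟨h1, z, hz⟩ := of_partNum_eq_one_and_exists_int_partDen_eq hs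
        refine ⟨z * A' + A, z * B' + B, ?_⟩
        rw [contsAux_recurrence hs h h', h1, hz]
        push_cast
        simp

theorem contsAux_b_le_succ (v : ℝ) (n : ℕ) :
    ((of v).contsAux n).b ≤ ((of v).contsAux (n + 1)).b := by
  cases n with
  | zero => simp [contsAux]
  | succ n => exact of_den_mono

theorem one_le_dens {v : ℝ} (hv : ∀ n, ¬(of v).TerminatedAt n) (n : ℕ) :
    (1 : ℝ) ≤ (of v).dens n := by
  have h := succ_nth_fib_le_of_nth_den (v := v) (n := n) (Or.inr (hv _))
  have h1 : 1 ≤ Nat.fib (n + 1) := Nat.fib_pos.2 n.succ_pos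
  exact le_trans (by exact_mod_cast h1) h

/-- The convergents are reduced fractions. -/
theorem exists_rat_eq_convs_den_eq_dens {v : ℝ} (hv : ∀ n, ¬(of v).TerminatedAt n) (n : ℕ) :
    ∃ r : ℚ, (r : ℝ) = (of v).convs n ∧ (r.den : ℝ) = (of v).dens n := by
  obtain ⟨A, B, h⟩ := exists_int_contsAux v (n + 1)
  obtain ⟨A', B', h'⟩ := exists_int_contsAux v (n + 2)
  have hA : (of v).nums n = A := by change ((of v).contsAux (n + 1)).a = _; rw [h]
  have hB : (of v).dens n = B := by change ((of v).contsAux (n + 1)).b = _; rw [h]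
  have hA' : (of v).nums (n + 1) = A' := by change ((of v).contsAux (n + 2)).a = _; rw [h']
  have hB' : (of v).dens (n + 1) = B' := by change ((of v).contsAux (n + 2)).b = _; rw [h']
  have hdet : (of v).nums n * (of v).dens (n + 1) - (of v).dens n * (of v).nums (n + 1)
      = (-1) ^ (n + 1) := (SimpContFract.of v).determinant (hv n)
  rw [hA, hB, hA', hB'] at hdet
  have hdet' : A * B' - B * A' = (-1) ^ (n + 1) := by exact_mod_cast hdet
  have hpos : 0 < B := by
    have := one_le_dens hv n
    rw [hB] at this
    exact_mod_cast (by linarith : (0 : ℝ) < B)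
  have hcop : IsCoprime A B := by
    -- The determinant identity is a Bézout relation up to sign.
    refine ⟨(-1) ^ (n + 1) * B', -((-1) ^ (n + 1) * A'), ?_⟩
    have : ((-1 : ℤ) ^ (n + 1)) * (-1) ^ (n + 1) = 1 := by
      rw [← mul_pow]; norm_num
    calc _ = (-1) ^ (n + 1) * (A * B' - B * A') := by ring
      _ = 1 := by rw [hdet', this]
  refine ⟨(A : ℚ) / B, ?_, ?_⟩
  · rw [conv_eq_num_div_den, hA, hB]; push_cast; rfl
  · have := Rat.den_div_eq_of_coprime hpos (Int.isCoprime_iff_gcd_eq_one.1 hcop)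
    rw [hB]
    exact_mod_cast this

/-- Lower bound for the distance of a real number to its convergents. -/
theorem le_abs_sub_convs {v : ℝ} (hv : ∀ n, ¬(of v).TerminatedAt n) {n : ℕ} {b : ℝ}
    (hb : (of v).partDens.get? n = some b) :
    1 / ((b + 2) * (of v).dens n ^ 2) ≤ |v - (of v).convs n| := by
  obtain ⟨gp, hs, hgp⟩ := exists_s_b_of_partDen hb
  obtain ⟨ifp', hst', hb'⟩ := IntFractPair.exists_succ_get?_stream_of_gcf_of_get?_eq_some hs
  obtain ⟨ifp, hst, hfr, hof⟩ := IntFractPair.succ_nth_stream_eq_some_iff.1 hst'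
  have heq := sub_convs_eq hst
  simp only [hfr, if_false] at heq
  have hB : (1 : ℝ) ≤ (of v).dens n := one_le_dens hv n
  have hBdef : ((of v).contsAux (n + 1)).b = (of v).dens n := rfl
  have hpB := contsAux_b_le_succ v n
  have hpB0 : 0 ≤ ((of v).contsAux n).b := zero_le_of_contsAux_b
  rw [hBdef] at heq hpB
  -- The complete quotient has floor `b`; with the previous denominator at most the current one this
  -- yields `b + 2`.
  have hfl : ifp.fr⁻¹ < b + 1 := by
    have h1 : (ifp'.b : ℝ) = b := by rw [hb', hgp]
    have h2 : ifp'.b = ⌊ifp.fr⁻¹⌋ := by rw [← hof]; rfl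
    rw [← h1, h2]
    exact Int.lt_floor_add_one _
  have hfr0 : 0 < ifp.fr⁻¹ :=
    inv_pos.2 (lt_of_le_of_ne (IntFractPair.nth_stream_fr_nonneg hst) hfr.symm)
  rw [heq, abs_div, abs_neg_one_pow]
  have hden : 0 < (of v).dens n * (ifp.fr⁻¹ * (of v).dens n + ((of v).contsAux n).b) := by
    positivity
  rw [abs_of_pos hden]
  apply one_div_le_one_div_of_le hden
  nlinarith [mul_le_mul_of_nonneg_right hfl.le (by positivity : 0 ≤ (of v).dens n ^ 2)]

end GenContFract

/-! ### Diophantine approximation of α in terms of its coefficients. -/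

section

open GenContFract
open GenContFract (of)

theorem HasContFracCoeffs.not_terminatedAt {α : ℝ} {a : ℕ → ℕ} (h : HasContFracCoeffs α a)
    (n : ℕ) : ¬(of α).TerminatedAt n := by
  rw [terminatedAt_iff_partDen_none, h.coeff n]
  simp

theorem HasContFracCoeffs.irrational {α : ℝ} {a : ℕ → ℕ} (h : HasContFracCoeffs α a) :
    Irrational α := by
  rintro ⟨q, hq⟩
  obtain ⟨n, hn⟩ := (terminates_iff_rat α).2 ⟨q, hq.symm⟩
  exact h.not_terminatedAt n hn

/-- Infinitely many large partial quotients give infinitely many good rational approximations. -/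
theorem HasContFracCoeffs.exists_rat_abs_sub_le {α : ℝ} {a : ℕ → ℕ} (h : HasContFracCoeffs α a)
    {L : ℕ} (hL : 1 ≤ L) (hfreq : ∃ᶠ j in Filter.atTop, L ≤ a j) (Q : ℕ) :
    ∃ r : ℚ, Q ≤ r.den ∧ |α - r| ≤ 1 / (L * (r.den : ℝ) ^ 2) := by
  -- Denominators dominate Fibonacci numbers, and `n ≤ fib n` from `n = 5` on.
  obtain ⟨j, hj, hLj⟩ := Filter.frequently_atTop.1 hfreq (Q + 6)
  obtain ⟨n, rfl⟩ : ∃ n, j = n + 1 := ⟨j - 1, by omega⟩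
  obtain ⟨r, hr, hden⟩ := exists_rat_eq_convs_den_eq_dens h.not_terminatedAt n
  refine ⟨r, ?_, ?_⟩
  · have h1 := succ_nth_fib_le_of_nth_den (v := α) (n := n) (Or.inr (h.not_terminatedAt _))
    rw [← hden] at h1
    have h2 : Nat.fib (n + 1) ≤ r.den := by exact_mod_cast h1
    have h3 := Nat.le_fib_self (n := n + 1) (by omega)
    omega
  · have h1 := abs_sub_convergents_le' (h.coeff n)
    rw [← hr, ← hden] at h1
    refine h1.trans ?_
    have : (0 : ℝ) < r.den := by exact_mod_cast r.den_pos
    have hL0 : (0 : ℝ) < L := by exact_mod_cast hL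
    have hLa : (L : ℝ) ≤ a (n + 1) := by exact_mod_cast hLj
    rw [mul_assoc, ← sq]
    gcongr

/-- If the partial quotients are eventually at most `L`, then the multiples `m α` are
eventually at distance at least `1 / ((L + 2) m)` from the integers. -/
theorem HasContFracCoeffs.exists_le_abs_mul_sub {α : ℝ} {a : ℕ → ℕ} (h : HasContFracCoeffs α a)
    {L : ℕ} (hev : ∀ᶠ j in Filter.atTop, a j ≤ L) :
    ∃ m₀ : ℕ, ∀ m : ℕ, 1 ≤ m → m₀ ≤ m → ∀ k : ℤ, 1 / (((L : ℝ) + 2) * m) ≤ |m * α - k| := by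
  obtain ⟨n₀, hn₀⟩ := Filter.eventually_atTop.1 hev
  have hpos : ∀ n, 0 < |α - (of α).convs n| := by
    intro n
    obtain ⟨r, hr, -⟩ := exists_rat_eq_convs_den_eq_dens h.not_terminatedAt n
    rw [← hr, abs_pos, sub_ne_zero]
    exact h.irrational.ne_rat r
  -- The finitely many convergents before the coefficient bound sets in stay away from α, hence
  -- cannot serve large `m`.
  obtain ⟨η, hη, hη'⟩ : ∃ η > 0, ∀ n < n₀, η ≤ |α - (of α).convs n| := by
    clear hn₀ hev
    induction n₀ with
    | zero => exact ⟨1, one_pos, by simp⟩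
    | succ k ih =>
      obtain ⟨η, hη, hη'⟩ := ih
      refine ⟨min η |α - (of α).convs k|, lt_min hη (hpos k), fun n hn => ?_⟩
      rcases Nat.lt_succ_iff_lt_or_eq.1 hn with hn | rfl
      · exact (min_le_left _ _).trans (hη' n hn)
      · exact min_le_right _ _
  obtain ⟨m₀, hm₀⟩ := exists_nat_gt (1 / η)
  refine ⟨m₀, fun m hm1 hm k => ?_⟩
  by_contra! hlt
  have hmpos : (0 : ℝ) < m := by exact_mod_cast hm1
  have hL0 : (0 : ℝ) ≤ L := Nat.cast_nonneg L
  set r : ℚ := (k : ℚ) / m with hr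
  have hrr : (r : ℝ) = (k : ℝ) / m := by rw [hr]; push_cast; rfl
  have hdvd : r.den ∣ m := by
    have := Rat.den_dvd k m
    rw [hr]
    exact_mod_cast this
  have hdm : (r.den : ℝ) ≤ m := by exact_mod_cast Nat.le_of_dvd hm1 hdvd
  have hd : (0 : ℝ) < r.den := by exact_mod_cast r.den_pos
  have hlt' : |α - r| < 1 / ((L + 2) * (m : ℝ) ^ 2) := by
    have : α - r = (m * α - k) / m := by rw [hrr]; field_simp
    rw [this, abs_div, abs_of_pos hmpos, div_lt_iff₀ hmpos]
    refine hlt.trans_eq ?_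
    field_simp
  -- Legendre: an approximation this good is a convergent.
  obtain ⟨n, hn⟩ := Real.exists_convs_eq_rat (ξ := α) (q := r) <| hlt'.trans_le <| by
    gcongr
    linarith
  by_cases hnn : n < n₀
  · have h1 := hη' n hnn
    rw [hn] at h1
    have h2 : 1 / ((L + 2) * (m : ℝ) ^ 2) ≤ 1 / m := by
      apply one_div_le_one_div_of_le hmpos
      have : (1 : ℝ) ≤ m := by exact_mod_cast hm1
      nlinarith [mul_nonneg hL0 (sq_nonneg (m : ℝ))]
    have h3 : (1 : ℝ) / m < η := by
      rw [div_lt_comm₀ hmpos hη]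
      exact hm₀.trans_le (by exact_mod_cast hm)
    linarith
  · obtain ⟨r', hr', hden⟩ := exists_rat_eq_convs_den_eq_dens h.not_terminatedAt n
    have hrr' : r' = r := by exact_mod_cast hr'.trans hn
    subst hrr'
    have h1 := le_abs_sub_convs h.not_terminatedAt (h.coeff n)
    rw [hn, ← hden] at h1
    have h2 : (a (n + 1) : ℝ) ≤ L := by exact_mod_cast hn₀ (n + 1) (by omega)
    have h3 : 1 / (((L : ℝ) + 2) * m ^ 2) ≤ 1 / (((a (n + 1) : ℝ) + 2) * (r.den : ℝ) ^ 2) := by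
      gcongr
    linarith

end

/-! ### Comparison of the product at α with the product at p/q. -/

/-- Tangent-line bound for the concave function log sin, obtained from the mean value theorem and
the monotonicity of cot. -/
theorem Real.sin_add_le_sin_mul_exp {x y : ℝ} (hx : x ∈ Set.Ioo 0 Real.pi)
    (hxy : x + y ∈ Set.Ioo 0 Real.pi) :
    Real.sin (x + y) ≤ Real.sin x * Real.exp (y * (Real.cos x / Real.sin x)) := by
  have hsin : ∀ t ∈ Set.Ioo 0 Real.pi, 0 < Real.sin t := fun t ht =>
    Real.sin_pos_of_pos_of_lt_pi ht.1 ht.2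
  have hder : ∀ t ∈ Set.Ioo 0 Real.pi,
      HasDerivAt (fun t => Real.log (Real.sin t)) (Real.cos t / Real.sin t) t := fun t ht =>
    (Real.hasDerivAt_sin t).log (hsin t ht).ne'
  have hcot : ∀ s ∈ Set.Ioo 0 Real.pi, ∀ t ∈ Set.Ioo 0 Real.pi, s ≤ t →
      Real.cos t / Real.sin t ≤ Real.cos s / Real.sin s := by
    intro s hs t ht hst
    rw [div_le_div_iff₀ (hsin t ht) (hsin s hs)]
    have : 0 ≤ Real.sin (t - s) :=
      Real.sin_nonneg_of_nonneg_of_le_pi (by linarith) (by linarith [hs.1, ht.2])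
    rw [Real.sin_sub] at this
    linarith
  have key : Real.log (Real.sin (x + y)) ≤
      Real.log (Real.sin x) + y * (Real.cos x / Real.sin x) := by
    rcases lt_trichotomy y 0 with hy | rfl | hy
    · have hsub : Set.Icc (x + y) x ⊆ Set.Ioo 0 Real.pi := fun t ht =>
        ⟨hxy.1.trans_le ht.1, ht.2.trans_lt hx.2⟩
      obtain ⟨c, hc, hc'⟩ := exists_hasDerivAt_eq_slope (fun t => Real.log (Real.sin t)) _
        (by linarith : x + y < x)
        (fun t ht => (hder t (hsub ht)).continuousAt.continuousWithinAt)
        (fun t ht => hder t (hsub (Set.Ioo_subset_Icc_self ht)))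
      have h1 := hcot c (hsub (Set.Ioo_subset_Icc_self hc)) x hx hc.2.le
      rw [hc', le_div_iff₀ (by linarith)] at h1
      linarith
    · simp
    · have hsub : Set.Icc x (x + y) ⊆ Set.Ioo 0 Real.pi := fun t ht =>
        ⟨hx.1.trans_le ht.1, ht.2.trans_lt hxy.2⟩
      obtain ⟨c, hc, hc'⟩ := exists_hasDerivAt_eq_slope (fun t => Real.log (Real.sin t)) _
        (by linarith : x < x + y)
        (fun t ht => (hder t (hsub ht)).continuousAt.continuousWithinAt)
        (fun t ht => hder t (hsub (Set.Ioo_subset_Icc_self ht)))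
      have h1 := hcot x hx c (hsub (Set.Ioo_subset_Icc_self hc)) hc.1.le
      rw [hc', div_le_iff₀ (by linarith)] at h1
      linarith
  rw [← Real.exp_log (hsin _ hxy), ← Real.exp_log (hsin _ hx), ← Real.exp_add,
    Real.exp_log (hsin _ hx)]
  exact Real.exp_le_exp.2 key

theorem Real.abs_sin_add_le_abs_sin_mul_exp {x y : ℝ} (n : ℤ) (hx : x ∈ Set.Ioo 0 Real.pi)
    (hxy : x + y ∈ Set.Ioo 0 Real.pi) :
    |Real.sin (x + n * Real.pi + y)| ≤
      |Real.sin (x + n * Real.pi)| * Real.exp (y * (Real.cos x / Real.sin x)) := by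
  have h1 : x + n * Real.pi + y = (x + y) + n * Real.pi := by ring
  have h2 : |((-1 : ℝ) ^ n)| = 1 := by rw [abs_zpow]; simp
  rw [h1, Real.sin_add_int_mul_pi, Real.sin_add_int_mul_pi, abs_mul, abs_mul, h2, one_mul, one_mul,
    abs_of_pos (Real.sin_pos_of_pos_of_lt_pi hx.1 hx.2),
    abs_of_pos (Real.sin_pos_of_pos_of_lt_pi hxy.1 hxy.2)]
  exact Real.sin_add_le_sin_mul_exp hx hxy

/-- Since |2 sin πx| = |e^{2πix} - 1|, this is the norm of ∏(1 - ζ^k) = q for a primitive q-th root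
of unity ζ. -/
theorem prod_abs_two_mul_sin_eq {q : ℕ} (hq : 0 < q) {p : ℤ} (hpq : IsCoprime p q) :
    ∏ r ∈ Finset.Ico 1 q, |2 * Real.sin (Real.pi * r * (p / q))| = q := by
  obtain ⟨n, rfl⟩ : ∃ n, q = n + 1 := ⟨q - 1, by omega⟩
  have hμ : IsPrimitiveRoot (Complex.exp (2 * Real.pi * Complex.I / (n + 1 : ℕ)) ^ p) (n + 1) :=
    (Complex.isPrimitiveRoot_exp (n + 1) hq.ne').zpow_of_gcd_eq_one p
      (Int.isCoprime_iff_gcd_eq_one.1 hpq)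
  have h := congrArg norm hμ.prod_one_sub_pow_eq_order
  rw [norm_prod] at h
  rw [Finset.prod_Ico_eq_prod_range, Nat.add_sub_cancel]
  have h3 : ‖((n : ℂ) + 1)‖ = ((n + 1 : ℕ) : ℝ) := by
    rw [← Nat.cast_add_one, Complex.norm_natCast]
  refine Eq.trans ?_ (h.trans h3)
  refine Finset.prod_congr rfl fun k _ => ?_
  rw [← norm_neg, neg_sub, ← Complex.exp_int_mul, ← Complex.exp_nat_mul]
  have h4 : ((k + 1 : ℕ) : ℂ) * ((p : ℂ) * (2 * Real.pi * Complex.I / (n + 1 : ℕ))) =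
      Complex.I * ((2 * (Real.pi * (k + 1 : ℕ) * (p / (n + 1 : ℕ))) : ℝ) : ℂ) := by
    push_cast
    ring
  rw [h4, Complex.norm_exp_I_mul_ofReal_sub_one, Real.norm_eq_abs, add_comm 1 k]
  congr 3
  ring

/-- Comparison of the Sudler product at `α` with the one at a nearby fraction `p / q`. -/
theorem prod_abs_two_mul_sin_le {q : ℕ} (hq : 0 < q) {p : ℤ} (hpq : IsCoprime p q) {α : ℝ}
    (hα : |α - p / q| ≤ 1 / (q : ℝ) ^ 2) :
    ∏ r ∈ Finset.Ico 1 q, |2 * Real.sin (Real.pi * r * α)| ≤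
      q * Real.exp (Real.pi * (α - p / q) * ∑ r ∈ Finset.Ico 1 q,
        r * Real.cot (Real.pi * (r * p % q : ℤ) / q)) := by
  have hq0 : (0 : ℝ) < q := by exact_mod_cast hq
  have hterm : ∀ r ∈ Finset.Ico 1 q, |2 * Real.sin (Real.pi * r * α)| ≤
      |2 * Real.sin (Real.pi * r * (p / q))| * Real.exp (Real.pi * (α - p / q) *
        (r * Real.cot (Real.pi * (r * p % q : ℤ) / q))) := by
    intro r hr
    rw [Finset.mem_Ico] at hr
    set k : ℤ := r * p % q with hk
    have hk0 : 0 ≤ k := Int.emod_nonneg _ (by omega)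
    have hkq : k < q := Int.emod_lt_of_pos _ (by omega)
    have hk1 : k ≠ 0 := by
      intro h0
      have h1 : (q : ℤ) ∣ r * p := Int.dvd_of_emod_eq_zero (hk ▸ h0)
      have h2 : (q : ℤ) ∣ r := hpq.symm.dvd_of_dvd_mul_right h1
      have h3 := Nat.le_of_dvd (by omega) (Int.natCast_dvd_natCast.1 h2)
      omega
    have hdiv : (r : ℝ) * p = k + q * ((r * p / q : ℤ) : ℝ) := by
      exact_mod_cast (Int.emod_add_mul_ediv (r * p) q).symm
    have hk1' : (1 : ℝ) ≤ k := by exact_mod_cast (by omega : 1 ≤ k)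
    have hkq' : (k : ℝ) ≤ q - 1 := by
      have : k ≤ q - 1 := by omega
      exact_mod_cast this
    have hrq : (r : ℝ) < q := by exact_mod_cast hr.2
    have hr0 : (0 : ℝ) < r := by exact_mod_cast hr.1
    -- The points k/q lie in [1/q, 1 - 1/q], so a perturbation below 1/q crosses no zero of the
    -- sine.
    have hrδ : |r * (α - p / q)| < 1 / q := by
      rw [abs_mul, abs_of_pos hr0]
      calc r * |α - p / q| ≤ r * (1 / (q : ℝ) ^ 2) := by gcongr
        _ < q * (1 / (q : ℝ) ^ 2) := by gcongr
        _ = 1 / q := by field_simp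
    rw [abs_lt] at hrδ
    have e1 : (1 : ℝ) / q ≤ k / q := by gcongr
    have e2 : (k : ℝ) / q ≤ 1 - 1 / q := by
      rw [div_le_iff₀ hq0, sub_mul, div_mul_cancel₀ _ hq0.ne']
      linarith
    have e0 : (0 : ℝ) < 1 / q := by positivity
    have hpi := Real.pi_pos
    have hA : Real.pi * r * (p / q) = Real.pi * k / q + ((r * p / q : ℤ) : ℝ) * Real.pi := by
      have : Real.pi * r * (p / q) = Real.pi * (r * p) / q := by ring
      rw [this, hdiv]
      field_simp
    have hB : Real.pi * r * α = Real.pi * k / q + ((r * p / q : ℤ) : ℝ) * Real.pi +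
        Real.pi * (r * (α - p / q)) := by
      rw [← hA]
      ring
    have hX : Real.pi * k / q ∈ Set.Ioo 0 Real.pi := by
      rw [mul_div_assoc]
      constructor
      · nlinarith
      · nlinarith
    have hXY : Real.pi * k / q + Real.pi * (r * (α - p / q)) ∈ Set.Ioo 0 Real.pi := by
      rw [mul_div_assoc, ← mul_add]
      constructor
      · nlinarith
      · nlinarith
    rw [hB, hA, abs_mul, abs_mul, mul_assoc]
    refine mul_le_mul_of_nonneg_left ?_ (abs_nonneg _)
    refine (Real.abs_sin_add_le_abs_sin_mul_exp (r * p / q : ℤ) hX hXY).trans_eq ?_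
    rw [Real.cot_eq_cos_div_sin]
    congr 2
    ring
  calc _ ≤ ∏ r ∈ Finset.Ico 1 q, (|2 * Real.sin (Real.pi * r * (p / q))| *
        Real.exp (Real.pi * (α - p / q) * (r * Real.cot (Real.pi * (r * p % q : ℤ) / q)))) :=
        Finset.prod_le_prod (fun _ _ => abs_nonneg _) hterm
    _ = _ := by
        rw [Finset.prod_mul_distrib, prod_abs_two_mul_sin_eq hq hpq, ← Real.exp_sum,
          ← Finset.mul_sum]

/-! ### Sawtooth sums along multiples of a badly approximable number. -/

theorem sum_range_add_mul_emod {d : ℕ} (hd : 0 < d) {e : ℤ} (hed : IsCoprime e d) (Y : ℤ)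
    (φ : ℤ → ℝ) :
    ∑ j ∈ Finset.range d, φ ((Y + j * e) % d) = ∑ n ∈ Finset.range d, φ n := by
  have hd0 : (d : ℤ) ≠ 0 := by exact_mod_cast hd.ne'
  have hnn : ∀ z : ℤ, 0 ≤ z % d := fun z => Int.emod_nonneg _ hd0
  have hlt : ∀ z : ℤ, z % d < d := fun z => Int.emod_lt_of_pos _ (by omega)
  have hmaps : ∀ j ∈ Finset.range d, ((Y + j * e) % d).toNat ∈ Finset.range d := by
    intro j _
    rw [Finset.mem_range]
    have := hnn (Y + j * e)
    have := hlt (Y + j * e)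
    omega
  have hinj : Set.InjOn (fun j : ℕ => ((Y + j * e) % d).toNat) (Finset.range d) := by
    intro j hj k hk hjk
    simp only [Finset.coe_range, Set.mem_Iio] at hj hk
    have h1 : (Y + j * e) % d = (Y + k * e) % d := by
      have h2 := hnn (Y + j * e)
      have h3 := hnn (Y + k * e)
      simp only at hjk
      omega
    have h4 : (d : ℤ) ∣ (k - j) * e := by
      have := Int.ModEq.dvd h1
      convert this using 1
      ring
    have h5 : (d : ℤ) ∣ k - j := hed.symm.dvd_of_dvd_mul_right h4
    have h6 := Int.eq_zero_of_abs_lt_dvd h5 (by rw [abs_lt]; constructor <;> omega)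
    omega
  refine Finset.sum_nbij _ hmaps hinj
    (Finset.surjOn_of_injOn_of_card_le _ hmaps hinj le_rfl) fun j _ => ?_
  rw [Int.toNat_of_nonneg (hnn _)]

/-- Modulo 1 the d points lie within O(1/d) of the distinct fractions n/d, whose sawtooth sum is
-1/2. The shifts cost O(1) in total, and at most three points can wrap around an integer. -/
theorem sum_range_fract_block {d : ℕ} (hd : 0 < d) {e : ℤ} (hed : IsCoprime e d) {x : ℝ}
    (hx : |x - e / d| ≤ 1 / (d : ℝ) ^ 2) (y : ℝ) :
    |∑ j ∈ Finset.range d, (Int.fract (j * x + y) - 1 / 2)| ≤ 7 / 2 := by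
  have hd0 : (0 : ℝ) < d := by exact_mod_cast hd
  set Y : ℤ := ⌊d * y⌋ with hY
  have hY1 := Int.floor_le (d * y)
  have hY2 := Int.lt_floor_add_one (d * y)
  rw [← hY] at hY1 hY2
  -- the `j`-th point is close to `n / d` with `n = (Y + j e) % d`
  have key : ∀ j ∈ Finset.range d, ∃ η : ℝ, -(1 / d) ≤ η ∧ η < 2 / d ∧
      Int.fract (j * x + y) = Int.fract ((((Y + j * e) % d : ℤ) : ℝ) / d + η) := by
    intro j hj
    have hjd : (j : ℝ) ≤ d := by exact_mod_cast (Finset.mem_range.1 hj).le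
    have hθ : |j * (x - e / d)| ≤ 1 / d := by
      rw [abs_mul, Nat.abs_cast]
      calc (j : ℝ) * |x - e / d| ≤ d * (1 / (d : ℝ) ^ 2) := by gcongr
        _ = 1 / d := by field_simp
    rw [abs_le] at hθ
    have hfr1 : 0 ≤ (d * y - Y) / d := div_nonneg (by linarith) hd0.le
    have hfr2 : (d * y - Y) / d < 1 / d := by gcongr; linarith
    refine ⟨(d * y - Y) / d + j * (x - e / d), by linarith, ?_, ?_⟩
    · have : (2 : ℝ) / d = 1 / d + 1 / d := by ring
      linarith
    · have hdiv : (Y : ℝ) + j * e = ((Y + j * e) % d : ℤ) + d * (((Y + j * e) / d : ℤ) : ℝ) := by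
        exact_mod_cast (Int.emod_add_mul_ediv (Y + j * e) d).symm
      have : (j : ℝ) * x + y = (((Y + j * e) % d : ℤ) : ℝ) / d +
          ((d * y - Y) / d + j * (x - e / d)) + (((Y + j * e) / d : ℤ) : ℝ) := by
        have h1 : (((Y + j * e) % d : ℤ) : ℝ) = Y + j * e - d * (((Y + j * e) / d : ℤ) : ℝ) := by
          linarith
        rw [h1]
        field_simp
        ring
      rw [this, Int.fract_add_intCast]
  -- Only n = 0 can be pushed below an integer, gaining at most 1.
  have hup : ∀ j ∈ Finset.range d, Int.fract (j * x + y) ≤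
      (fun n : ℤ => (n : ℝ) / d + 2 / d + if n = 0 then 1 else 0) ((Y + j * e) % d) := by
    intro j hj
    obtain ⟨η, h1, h2, h3⟩ := key j hj
    rw [h3]
    set n : ℤ := (Y + j * e) % d
    have hn : 0 ≤ n := Int.emod_nonneg _ (by omega)
    have hnd : (0 : ℝ) ≤ n / d := div_nonneg (by exact_mod_cast hn) hd0.le
    have h2d : (0 : ℝ) ≤ 2 / d := by positivity
    simp only
    split_ifs with h0
    · have := Int.fract_lt_one ((n : ℝ) / d + η)
      linarith
    · have h4 : (1 : ℝ) ≤ n := by exact_mod_cast (by omega : 1 ≤ n)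
      have h5 : (1 : ℝ) / d ≤ n / d := by gcongr
      have h6 : 0 ≤ ⌊(n : ℝ) / d + η⌋ := Int.floor_nonneg.2 (by linarith)
      have h7 : (0 : ℝ) ≤ ⌊(n : ℝ) / d + η⌋ := by exact_mod_cast h6
      have h8 := Int.self_sub_floor ((n : ℝ) / d + η)
      linarith
  -- As η < 2/d, only the last two residues can be pushed past 1.
  have hlow : ∀ j ∈ Finset.range d,
      (fun n : ℤ => (n : ℝ) / d - 1 / d - if (d : ℤ) - 2 ≤ n then 1 else 0) ((Y + j * e) % d) ≤
        Int.fract (j * x + y) := by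
    intro j hj
    obtain ⟨η, h1, h2, h3⟩ := key j hj
    rw [h3]
    set n : ℤ := (Y + j * e) % d
    have hn : n < d := Int.emod_lt_of_pos _ (by omega)
    have h1d : (0 : ℝ) ≤ 1 / d := by positivity
    simp only
    split_ifs with h0
    · have h4 : (n : ℝ) / d ≤ 1 := by
        rw [div_le_one hd0]
        exact_mod_cast hn.le
      have := Int.fract_nonneg ((n : ℝ) / d + η)
      linarith
    · have h4 : (n : ℝ) + 2 ≤ d := by exact_mod_cast (by omega : n + 2 ≤ d)
      have h5 : ((n : ℝ) + 2) / d ≤ 1 := by rwa [div_le_one hd0]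
      rw [add_div] at h5
      have h6 : ⌊(n : ℝ) / d + η⌋ < 1 := Int.floor_lt.2 (by push_cast; linarith)
      have h7 : (⌊(n : ℝ) / d + η⌋ : ℝ) ≤ 0 := Int.cast_nonpos.2 (by omega)
      have h8 := Int.self_sub_floor ((n : ℝ) / d + η)
      linarith
  have hsum : ∑ n ∈ Finset.range d, ((n : ℤ) : ℝ) / d = (d - 1) / 2 := by
    rw [← Finset.sum_div]
    push_cast
    have := Finset.sum_range_id_mul_two d
    have h2 : (∑ i ∈ Finset.range d, (i : ℝ)) * 2 = d * (d - 1) := by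
      have : ((∑ i ∈ Finset.range d, i : ℕ) : ℝ) * 2 = d * ((d - 1 : ℕ) : ℝ) := by
        exact_mod_cast this
      rw [Nat.cast_sub hd] at this
      push_cast at this
      exact this
    rw [div_eq_iff hd0.ne']
    linarith
  have hc1 : ∑ n ∈ Finset.range d, (if (n : ℤ) = 0 then (1 : ℝ) else 0) ≤ 1 := by
    rw [Finset.sum_boole]
    have : (Finset.filter (fun n : ℕ => (n : ℤ) = 0) (Finset.range d)).card ≤ 1 := by
      rw [Finset.card_le_one]
      intro a ha b hb
      simp only [Finset.mem_filter] at ha hb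
      omega
    exact_mod_cast this
  have hc2 : ∑ n ∈ Finset.range d, (if (d : ℤ) - 2 ≤ (n : ℤ) then (1 : ℝ) else 0) ≤ 2 := by
    rw [Finset.sum_boole]
    have h1 : Finset.filter (fun n : ℕ => (d : ℤ) - 2 ≤ (n : ℤ)) (Finset.range d) ⊆
        {d - 2, d - 1} := by
      intro a ha
      simp only [Finset.mem_filter, Finset.mem_range, Finset.mem_insert,
        Finset.mem_singleton] at ha ⊢
      omega
    have h2 := (Finset.card_le_card h1).trans Finset.card_le_two
    exact_mod_cast h2
  have hU := (Finset.sum_le_sum hup).trans_eq (sum_range_add_mul_emod hd hed Y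
    (fun n : ℤ => (n : ℝ) / d + 2 / d + if n = 0 then 1 else 0))
  have hL := (sum_range_add_mul_emod hd hed Y
    (fun n : ℤ => (n : ℝ) / d - 1 / d - if (d : ℤ) - 2 ≤ n then 1 else 0)).symm.trans_le
      (Finset.sum_le_sum hlow)
  simp only [Finset.sum_add_distrib, Finset.sum_sub_distrib, hsum, Finset.sum_const,
    Finset.card_range, nsmul_eq_mul] at hU hL ⊢
  have e1 : (d : ℝ) * (2 / d) = 2 := by field_simp
  have e2 : (d : ℝ) * (1 / d) = 1 := by field_simp
  rw [abs_le]
  constructor <;> linarith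

theorem abs_sum_range_fract_le_of_blocks {d : ℕ} (hd : 0 < d) {e : ℤ} (hed : IsCoprime e d)
    {x : ℝ} (hx : |x - e / d| ≤ 1 / (d : ℝ) ^ 2) {r : ℕ} {C : ℝ}
    (hC : ∀ y : ℝ, |∑ j ∈ Finset.range r, (Int.fract (j * x + y) - 1 / 2)| ≤ C) (m : ℕ) (y : ℝ) :
    |∑ j ∈ Finset.range (d * m + r), (Int.fract (j * x + y) - 1 / 2)| ≤ m * (7 / 2) + C := by
  induction m generalizing y with
  | zero => simpa using hC y
  | succ m ih =>
    have : d * (m + 1) + r = d + (d * m + r) := by ring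
    rw [this, Finset.sum_range_add]
    have h1 := sum_range_fract_block hd hed hx y
    have h2 := ih (d * x + y)
    have h3 : ∀ j : ℕ, ((d + j : ℕ) : ℝ) * x + y = j * x + (d * x + y) := by
      intro j
      push_cast
      ring
    simp only [h3]
    refine (abs_add_le _ _).trans ?_
    push_cast
    linarith

/-- Sums of the sawtooth function along the multiples of a number that is badly approximable
up to height `N` grow at most logarithmically. -/
theorem abs_sum_range_fract_le {x B : ℝ} (hB : 0 < B) (N : ℕ)
    (hx : ∀ j : ℕ, 1 ≤ j → j ≤ N → ∀ i : ℤ, 1 / (B * j) ≤ |j * x - i|) (y : ℝ) :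
    |∑ j ∈ Finset.range N, (Int.fract (j * x + y) - 1 / 2)| ≤ 6 * B * (Real.log N + 1) := by
  induction N using Nat.strong_induction_on generalizing y with
  | _ N ih =>
    rcases Nat.eq_zero_or_pos N with rfl | hN
    · simp only [Finset.range_zero, Finset.sum_empty, abs_zero, Nat.cast_zero, Real.log_zero]
      linarith
    obtain ⟨r, hr, hrN⟩ := Real.exists_rat_abs_sub_le_and_den_le x hN
    set d := r.den with hd
    have hd0 : 0 < d := r.den_pos
    have hdR : (0 : ℝ) < d := by exact_mod_cast hd0
    have hNR : (0 : ℝ) < N := by exact_mod_cast hN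
    have hdN : (d : ℝ) ≤ N := by exact_mod_cast hrN
    have hcop : IsCoprime r.num (d : ℤ) := Rat.isCoprime_num_den r
    have hrr : (r : ℝ) = r.num / d := Rat.cast_def r
    have hxd : |x - r.num / d| ≤ 1 / (d : ℝ) ^ 2 := by
      rw [← hrr]
      refine hr.trans (one_div_le_one_div_of_le (by positivity) ?_)
      rw [sq]
      gcongr
      linarith
    -- Dirichlet gives ‖dx‖ ≤ 1/(N+1), bad approximability gives ‖dx‖ ≥ 1/(Bd); so there are at most
    -- B blocks.
    have hmB : ((N / d : ℕ) : ℝ) ≤ B := by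
      have h1 := hx d hd0 hrN r.num
      have h2 : |d * x - r.num| ≤ 1 / (N + 1) := by
        have : d * x - r.num = d * (x - r) := by rw [hrr]; field_simp
        rw [this, abs_mul, Nat.abs_cast]
        calc (d : ℝ) * |x - r| ≤ d * (1 / ((N + 1) * d)) := by gcongr
          _ = 1 / (N + 1) := by field_simp
      have h3 := h1.trans h2
      rw [one_div_le_one_div (by positivity) (by positivity)] at h3
      have h4 : ((N / d : ℕ) : ℝ) ≤ N / d := Nat.cast_div_le
      refine h4.trans ?_
      rw [div_le_iff₀ hdR]
      linarith
    have hlogN : 0 ≤ Real.log N := Real.log_natCast_nonneg N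
    have hrlt : N % d < d := Nat.mod_lt _ hd0
    have hsplit : d * (N / d) + N % d = N := Nat.div_add_mod N d
    have hq1 : 1 ≤ N / d := Nat.div_pos hrN hd0
    have h2r : 2 * (N % d) ≤ N := by nlinarith
    -- The remainder is at most N/2, so induction saves 6B log 2, which exceeds the 7B/2 spent on
    -- blocks.
    have hmain := abs_sum_range_fract_le_of_blocks hd0 hcop hxd (r := N % d)
      (C := 6 * B * (Real.log N + 1) - 7 / 2 * B) ?_ (N / d) y
    · rw [hsplit] at hmain
      linarith
    · intro y
      rcases Nat.eq_zero_or_pos (N % d) with h0 | h0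
      · rw [h0, Finset.range_zero, Finset.sum_empty, abs_zero]
        nlinarith
      · have h1 := ih (N % d) (by omega) (fun j hj hj' => hx j hj (by omega)) y
        have h2 : Real.log (N % d : ℕ) ≤ Real.log N - Real.log 2 := by
          rw [← Real.log_div hNR.ne' two_ne_zero]
          apply Real.log_le_log (by exact_mod_cast h0)
          rw [le_div_iff₀ two_pos]
          have : ((N % d : ℕ) : ℝ) * 2 = ((2 * (N % d) : ℕ) : ℝ) := by push_cast; ring
          rw [this]
          exact_mod_cast h2r
        have h3 := Real.log_two_gt_d9
        nlinarith

/-! ### The cotangent sum. -/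

/-- Telescoping against (log k + 2)/k, using log(k+1) ≤ log k + 1/k. -/
theorem sum_Ico_log_div_le {a : ℕ} (ha : 1 ≤ a) (b : ℕ) :
    ∑ k ∈ Finset.Ico a b, (Real.log k + 1) / (k * (k + 1)) ≤ (Real.log a + 2) / a := by
  rcases le_total b a with hab | hab
  · rw [Finset.Ico_eq_empty_of_le hab, Finset.sum_empty]
    have := Real.log_natCast_nonneg a
    positivity
  suffices h : ∑ k ∈ Finset.Ico a b, (Real.log k + 1) / (k * (k + 1)) ≤
      (Real.log a + 2) / a - (Real.log b + 2) / b by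
    have := Real.log_natCast_nonneg b
    have : 0 ≤ (Real.log b + 2) / b := by positivity
    linarith
  induction b, hab using Nat.le_induction with
  | base => simp
  | succ b hab ih =>
    rw [Finset.sum_Ico_succ_top hab]
    have hb : (0 : ℝ) < b := by exact_mod_cast (by omega : 0 < b)
    have h1 : Real.log ((b + 1 : ℕ) : ℝ) ≤ Real.log b + 1 / b := by
      have h2 : ((b + 1 : ℕ) : ℝ) = b * (1 + 1 / b) := by push_cast; field_simp
      rw [h2, Real.log_mul hb.ne' (by positivity)]
      have := Real.log_le_sub_one_of_pos (x := 1 + 1 / (b : ℝ)) (by positivity)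
      linarith
    have h2 : (Real.log b + 1) / (b * (b + 1)) ≤
        (Real.log b + 2) / b - (Real.log ((b + 1 : ℕ) : ℝ) + 2) / ((b + 1 : ℕ) : ℝ) := by
      have h3 : (Real.log ((b + 1 : ℕ) : ℝ) + 2) / ((b + 1 : ℕ) : ℝ) ≤
          (Real.log b + 1 / b + 2) / ((b + 1 : ℕ) : ℝ) := by gcongr
      have h4 : (Real.log b + 2) / b - (Real.log b + 1 / b + 2) / ((b + 1 : ℕ) : ℝ) =
          (Real.log b + 1) / (b * (b + 1)) := by
        push_cast
        field_simp
        ring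
      linarith
    linarith

/-- Substitute r ≡ kp' modulo q: the cotangent becomes regular in k and the weight r/q becomes a
fractional part. -/
theorem sum_mul_cot_eq {q : ℕ} (hq : 0 < q) {p p' : ℤ} (hp : (q : ℤ) ∣ p * p' - 1) :
    ∑ r ∈ Finset.Ico 1 q, (r : ℝ) * Real.cot (Real.pi * (r * p % q : ℤ) / q) =
      q * ∑ k ∈ Finset.Ico 1 q, Int.fract (k * ((p' : ℝ) / q)) * Real.cot (Real.pi * k / q) := by
  have hq0 : (q : ℝ) ≠ 0 := by exact_mod_cast hq.ne'
  have hcop : IsCoprime p' (q : ℤ) := by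
    obtain ⟨t, ht⟩ := hp
    exact ⟨p, -t, by linarith⟩
  have h := sum_range_add_mul_emod hq hcop 0
    (fun n => (n : ℝ) * Real.cot (Real.pi * (n * p % q : ℤ) / q))
  rw [Finset.range_eq_Ico, Finset.sum_eq_sum_Ico_succ_bot hq,
    Finset.sum_eq_sum_Ico_succ_bot hq] at h
  simp only [Nat.cast_zero, zero_mul, add_zero, Int.zero_emod, Int.cast_zero, zero_add,
    Int.cast_natCast] at h
  rw [← h, Finset.mul_sum]
  refine Finset.sum_congr rfl fun k hk => ?_
  rw [Finset.mem_Ico] at hk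
  have h1 : k * p' % q * p % q = (k : ℤ) := by
    have h2 : k * p' % q * p ≡ k [ZMOD q] := by
      have h3 : k * p' % q ≡ k * p' [ZMOD q] := Int.mod_modEq _ _
      have h4 : k * (p * p') ≡ k * 1 [ZMOD q] :=
        (Int.modEq_iff_dvd.2 hp).symm.mul_left k
      refine (h3.mul_right p).trans ?_
      convert h4 using 1 <;> ring
    have h5 : (k : ℤ) % q = k := Int.emod_eq_of_lt (by omega) (by omega)
    exact Eq.trans h2 h5
  have h6 : Int.fract ((k : ℝ) * ((p' : ℝ) / q)) = ((k * p' % q : ℤ) : ℝ) / q := by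
    rw [← Int.fract_div_intCast_eq_div_intCast_mod]
    push_cast
    congr 1
    ring
  rw [h1, h6]
  push_cast
  field_simp

theorem sum_Ico_eq_two_mul_of_symm {q : ℕ} {f : ℕ → ℝ}
    (hf : ∀ k, 1 ≤ k → k < q → f (q - k) = f k) (hmid : ∀ k, 2 * k = q → f k = 0) :
    ∑ k ∈ Finset.Ico 1 q, f k = 2 * ∑ k ∈ Finset.range ((q - 1) / 2), f (k + 1) := by
  set h := (q - 1) / 2 with hh
  have e1 : ∑ k ∈ Finset.range h, f (k + 1) = ∑ k ∈ Finset.Ico 1 (h + 1), f k := by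
    rw [Finset.sum_Ico_eq_sum_range]
    simp [add_comm]
  have e2 : ∑ k ∈ Finset.Ico (q - h) q, f k = ∑ k ∈ Finset.Ico 1 (h + 1), f k := by
    refine Finset.sum_nbij' (fun k => q - k) (fun k => q - k) ?_ ?_ ?_ ?_ ?_ <;>
      intro k hk <;> rw [Finset.mem_Ico] at hk
    · rw [Finset.mem_Ico]; omega
    · rw [Finset.mem_Ico]; omega
    · omega
    · omega
    · exact (hf k (by omega) (by omega)).symm
  rw [e1, two_mul]
  nth_rewrite 2 [← e2]
  rcases Nat.eq_zero_or_pos q with rfl | hq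
  · simp [hh]
  rcases Nat.even_or_odd' q with ⟨c, hc | hc⟩
  · have h1 : q - h = c + 1 := by omega
    have h2 : h + 1 = c := by omega
    rw [h1, h2, ← Finset.sum_Ico_consecutive f (by omega : 1 ≤ c) (by omega : c ≤ q),
      Finset.sum_eq_sum_Ico_succ_bot (by omega : c < q), hmid c hc.symm, zero_add]
  · have h1 : q - h = h + 1 := by omega
    rw [h1, Finset.sum_Ico_consecutive f (by omega) (by omega)]

theorem sum_range_mul_by_parts (s c : ℕ → ℝ) {h : ℕ} (hh : 1 ≤ h) :
    ∑ k ∈ Finset.range h, s (k + 1) * c (k + 1) =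
      ∑ k ∈ Finset.Ico 1 h, (∑ j ∈ Finset.range k, s (j + 1)) * (c k - c (k + 1)) +
        (∑ j ∈ Finset.range h, s (j + 1)) * c h := by
  induction h, hh using Nat.le_induction with
  | base => simp
  | succ h hh ih =>
    rw [Finset.sum_range_succ, ih, Finset.sum_Ico_succ_top hh, Finset.sum_range_succ _ h]
    ring

theorem two_mul_div_le_sin {q k : ℕ} (hq : 0 < q) (hk : 2 * k ≤ q) :
    2 * (k : ℝ) / q ≤ Real.sin (Real.pi * k / q) := by
  have hq0 : (0 : ℝ) < q := by exact_mod_cast hq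
  have h2 : 2 * (k : ℝ) ≤ q := by exact_mod_cast hk
  have hpi := Real.pi_pos
  have := Real.mul_le_sin (x := Real.pi * k / q) (by positivity) (by
    rw [div_le_div_iff₀ hq0 two_pos]
    nlinarith)
  refine le_trans (le_of_eq ?_) this
  field_simp

theorem cot_nonneg_of_two_mul_le {q k : ℕ} (hq : 0 < q) (hk : 2 * k ≤ q) :
    0 ≤ Real.cot (Real.pi * k / q) := by
  have hq0 : (0 : ℝ) < q := by exact_mod_cast hq
  have h2 : 2 * (k : ℝ) ≤ q := by exact_mod_cast hk
  have hpi := Real.pi_pos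
  have h0 : 0 ≤ Real.pi * k / q := by positivity
  have h1 : Real.pi * k / q ≤ Real.pi / 2 := by
    rw [div_le_div_iff₀ hq0 two_pos]
    nlinarith
  rw [Real.cot_eq_cos_div_sin]
  exact div_nonneg (Real.cos_nonneg_of_neg_pi_div_two_le_of_le (by linarith) h1)
    (Real.sin_nonneg_of_nonneg_of_le_pi h0 (by linarith))

theorem cot_le_div {q k : ℕ} (hq : 0 < q) (hk1 : 1 ≤ k) (hk : 2 * k ≤ q) :
    Real.cot (Real.pi * k / q) ≤ q / (2 * k) := by
  have hq0 : (0 : ℝ) < q := by exact_mod_cast hq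
  have hk0 : (0 : ℝ) < k := by exact_mod_cast hk1
  have h := two_mul_div_le_sin hq hk
  have hpos : (0 : ℝ) < 2 * k / q := by positivity
  rw [Real.cot_eq_cos_div_sin]
  calc _ ≤ 1 / (2 * (k : ℝ) / q) :=
        div_le_div₀ zero_le_one (Real.cos_le_one _) hpos h
    _ = _ := by rw [one_div_div]

/-- From cot a - cot b = sin(b - a)/(sin a sin b), with Jordan's inequality in the denominator and π
≤ 4. -/
theorem cot_sub_cot_succ {q k : ℕ} (hq : 0 < q) (hk1 : 1 ≤ k) (hk : 2 * (k + 1) ≤ q) :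
    0 ≤ Real.cot (Real.pi * k / q) - Real.cot (Real.pi * (k + 1 : ℕ) / q) ∧
    Real.cot (Real.pi * k / q) - Real.cot (Real.pi * (k + 1 : ℕ) / q) ≤
      q / (k * (k + 1)) := by
  have hq0 : (0 : ℝ) < q := by exact_mod_cast hq
  have hk0 : (0 : ℝ) < k := by exact_mod_cast hk1
  have h1 := two_mul_div_le_sin hq (by omega : 2 * k ≤ q)
  have h2 := two_mul_div_le_sin hq hk
  have hp1 : (0 : ℝ) < 2 * k / q := by positivity
  have hp2 : (0 : ℝ) < 2 * (k + 1 : ℕ) / q := by positivity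
  have hs1 := hp1.trans_le h1
  have hs2 := hp2.trans_le h2
  have hpi := Real.pi_pos
  have heq : Real.cot (Real.pi * k / q) - Real.cot (Real.pi * (k + 1 : ℕ) / q) =
      Real.sin (Real.pi / q) /
        (Real.sin (Real.pi * k / q) * Real.sin (Real.pi * (k + 1 : ℕ) / q)) := by
    have h3 : Real.pi / q = Real.pi * (k + 1 : ℕ) / q - Real.pi * k / q := by
      push_cast
      ring
    rw [Real.cot_eq_cos_div_sin, Real.cot_eq_cos_div_sin, h3, Real.sin_sub]
    field_simp
  have hq1 : (1 : ℝ) ≤ q := by exact_mod_cast hq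
  have hs0 : 0 ≤ Real.sin (Real.pi / q) :=
    Real.sin_nonneg_of_nonneg_of_le_pi (by positivity) (div_le_self hpi.le hq1)
  rw [heq]
  refine ⟨by positivity, ?_⟩
  calc _ ≤ (4 / q) / ((2 * (k : ℝ) / q) * (2 * (k + 1 : ℕ) / q)) := by
        gcongr
        refine (Real.sin_le (by positivity)).trans ?_
        gcongr
        exact Real.pi_le_four
    _ = _ := by
        push_cast
        field_simp
        norm_num

theorem sum_cot_eq_zero (q : ℕ) : ∑ k ∈ Finset.Ico 1 q, Real.cot (Real.pi * k / q) = 0 := by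
  have h : ∑ k ∈ Finset.Ico 1 q, Real.cot (Real.pi * k / q) =
      ∑ k ∈ Finset.Ico 1 q, -Real.cot (Real.pi * k / q) := by
    refine Finset.sum_nbij' (fun k => q - k) (fun k => q - k) ?_ ?_ ?_ ?_ ?_ <;>
      intro k hk <;> rw [Finset.mem_Ico] at hk
    · rw [Finset.mem_Ico]; omega
    · rw [Finset.mem_Ico]; omega
    · omega
    · omega
    · have hq0 : (0 : ℝ) < q := by exact_mod_cast (by omega : 0 < q)
      have h1 : Real.pi * ((q - k : ℕ) : ℝ) / q = Real.pi - Real.pi * k / q := by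
        rw [Nat.cast_sub (by omega)]
        field_simp
      rw [h1, Real.cot_eq_cos_div_sin, Real.cot_eq_cos_div_sin, Real.cos_pi_sub, Real.sin_pi_sub]
      ring
  rw [Finset.sum_neg_distrib] at h
  linarith

/-- Summation by parts on half the range, in two regimes: `B₁` governs k below `T`, and `T` is so
large that the tail and the boundary term, governed by `B₂`, cost O(q) independently of `B₂`. -/
theorem abs_sum_mul_cot_le {q : ℕ} {p' : ℤ} (hcop : IsCoprime p' q) {B₁ B₂ : ℝ} (hB₁ : 0 ≤ B₁)
    (hB₂ : 0 ≤ B₂) {T : ℕ} (hT1 : 1 ≤ T)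
    (hT : ∀ t : ℕ, T ≤ t → 6 * B₂ * (Real.log t + 2) / t ≤ 1) (hTq : 2 * T < q)
    (hD₁ : ∀ k : ℕ, k ≤ T → |∑ j ∈ Finset.range k,
      (Int.fract (((j + 1 : ℕ) : ℝ) * ((p' : ℝ) / q)) - 1 / 2)| ≤ 6 * B₁ * (Real.log k + 1))
    (hD₂ : ∀ k : ℕ, k < q → |∑ j ∈ Finset.range k,
      (Int.fract (((j + 1 : ℕ) : ℝ) * ((p' : ℝ) / q)) - 1 / 2)| ≤ 6 * B₂ * (Real.log k + 1)) :
    |∑ k ∈ Finset.Ico 1 q, Int.fract (k * ((p' : ℝ) / q)) * Real.cot (Real.pi * k / q)| ≤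
      q * (24 * B₁ + 3) := by
  have hq : 0 < q := by omega
  have hq0 : (0 : ℝ) < q := by exact_mod_cast hq
  set s : ℕ → ℝ := fun k => Int.fract (k * ((p' : ℝ) / q)) - 1 / 2 with hs
  set c : ℕ → ℝ := fun k => Real.cot (Real.pi * k / q) with hc
  have hsc : ∑ k ∈ Finset.Ico 1 q, Int.fract (k * ((p' : ℝ) / q)) * Real.cot (Real.pi * k / q) =
      ∑ k ∈ Finset.Ico 1 q, s k * c k := by
    -- The cotangents sum to zero, so the fractional part may be centred; both factors are then odd
    -- under k ↦ q - k.
    have : ∀ k ∈ Finset.Ico 1 q, s k * c k =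
        Int.fract (k * ((p' : ℝ) / q)) * Real.cot (Real.pi * k / q) -
          1 / 2 * Real.cot (Real.pi * k / q) := fun k _ => by simp only [hs, hc]; ring
    rw [Finset.sum_congr rfl this, Finset.sum_sub_distrib, ← Finset.mul_sum, sum_cot_eq_zero]
    ring
  have hcrefl : ∀ k, k < q → c (q - k) = -c k := by
    intro k hk
    have h1 : Real.pi * ((q - k : ℕ) : ℝ) / q = Real.pi - Real.pi * k / q := by
      rw [Nat.cast_sub hk.le]
      field_simp
    simp only [hc]
    rw [h1, Real.cot_eq_cos_div_sin, Real.cot_eq_cos_div_sin, Real.cos_pi_sub, Real.sin_pi_sub]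
    ring
  have hsrefl : ∀ k, 1 ≤ k → k < q → s (q - k) = -s k := by
    intro k hk1 hk
    have h1 : ((q - k : ℕ) : ℝ) * ((p' : ℝ) / q) = p' + -(k * ((p' : ℝ) / q)) := by
      rw [Nat.cast_sub hk.le]
      field_simp
      ring
    have h2 : Int.fract ((k : ℝ) * ((p' : ℝ) / q)) ≠ 0 := by
      rw [Ne, Int.fract_eq_zero_iff]
      rintro ⟨z, hz⟩
      have h3 : (z : ℝ) * q = k * p' := by
        rw [hz]
        field_simp
      have h4 : z * q = k * p' := by exact_mod_cast h3
      have h5 : (q : ℤ) ∣ k := hcop.symm.dvd_of_dvd_mul_right ⟨z, by rw [← h4]; ring⟩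
      have h6 := Nat.le_of_dvd (by omega) (Int.natCast_dvd_natCast.1 h5)
      omega
    simp only [hs]
    rw [h1, Int.fract_intCast_add, Int.fract_neg h2]
    ring
  rw [hsc, sum_Ico_eq_two_mul_of_symm (f := fun k => s k * c k)]
  rotate_left
  · intro k hk1 hk
    rw [hcrefl k hk, hsrefl k hk1 hk]
    ring
  · intro k hk
    have := hcrefl k (by omega)
    rw [(by omega : q - k = k)] at this
    have h0 : c k = 0 := by linarith
    simp only [h0, mul_zero]
  set h := (q - 1) / 2 with hh
  have hTh : T ≤ h := by omega
  have hh0 : (0 : ℝ) < h := by exact_mod_cast (by omega : 0 < h)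
  have hlogh := Real.log_natCast_nonneg h
  rw [sum_range_mul_by_parts s c (by omega : 1 ≤ h)]
  set D : ℕ → ℝ := fun k => ∑ j ∈ Finset.range k, s (j + 1) with hDdef
  have hend : |D h * c h| ≤ q / 2 := by
    have h1 : |D h| ≤ 6 * B₂ * (Real.log h + 2) :=
      (hD₂ h (by omega)).trans (by gcongr; norm_num)
    have h2 : |c h| ≤ q / (2 * h) := by
      rw [abs_of_nonneg (cot_nonneg_of_two_mul_le hq (by omega))]
      exact cot_le_div hq (by omega) (by omega)
    rw [abs_mul]
    calc _ ≤ (6 * B₂ * (Real.log h + 2)) * (q / (2 * h)) := by gcongr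
      _ = (6 * B₂ * (Real.log h + 2) / h) * (q / 2) := by field_simp
      _ ≤ 1 * (q / 2) := by gcongr; exact hT h hTh
      _ = _ := one_mul _
  have hterm : ∀ k ∈ Finset.Ico 1 h, |D k * (c k - c (k + 1))| ≤
      q * (6 * B₁ * ((Real.log k + 1) / (k * (k + 1)))) +
        q * (if T ≤ k then 6 * B₂ * ((Real.log k + 1) / (k * (k + 1))) else 0) := by
    intro k hk
    rw [Finset.mem_Ico] at hk
    have hk0 : (0 : ℝ) < k := by exact_mod_cast hk.1
    have hlog := Real.log_natCast_nonneg k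
    obtain ⟨h1, h2⟩ := cot_sub_cot_succ hq hk.1 (by omega)
    rw [abs_mul, abs_of_nonneg (a := c k - c (k + 1)) h1]
    have hcase : |D k| ≤ 6 * B₁ * (Real.log k + 1) +
        (if T ≤ k then 6 * B₂ * (Real.log k + 1) else 0) := by
      split_ifs with hkT
      · have := hD₂ k (by omega)
        have h3 : 0 ≤ 6 * B₁ * (Real.log k + 1) := by positivity
        exact this.trans (by linarith)
      · rw [add_zero]
        exact hD₁ k (by omega)
    calc _ ≤ (6 * B₁ * (Real.log k + 1) +
          (if T ≤ k then 6 * B₂ * (Real.log k + 1) else 0)) * (q / (k * (k + 1))) := by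
          gcongr
      _ = _ := by split_ifs <;> ring
  have hsum : |∑ k ∈ Finset.Ico 1 h, D k * (c k - c (k + 1))| ≤ q * (12 * B₁ + 1) := by
    refine (Finset.abs_sum_le_sum_abs _ _).trans ((Finset.sum_le_sum hterm).trans ?_)
    rw [Finset.sum_add_distrib, ← Finset.mul_sum, ← Finset.mul_sum, ← Finset.mul_sum,
      ← mul_add]
    have h1 := sum_Ico_log_div_le le_rfl h
    norm_num at h1
    have h2 : ∑ k ∈ Finset.Ico 1 h,
        (if T ≤ k then 6 * B₂ * ((Real.log k + 1) / (k * (k + 1))) else 0) ≤ 1 := by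
      rw [← Finset.sum_filter]
      have hsub : Finset.filter (fun k => T ≤ k) (Finset.Ico 1 h) ⊆ Finset.Ico T h := by
        intro k hk
        rw [Finset.mem_filter, Finset.mem_Ico] at hk
        rw [Finset.mem_Ico]
        omega
      refine (Finset.sum_le_sum_of_subset_of_nonneg hsub fun k _ _ => ?_).trans ?_
      · have hlog := Real.log_natCast_nonneg k
        positivity
      · rw [← Finset.mul_sum]
        have h3 := mul_le_mul_of_nonneg_left (sum_Ico_log_div_le hT1 h)
          (by positivity : 0 ≤ 6 * B₂)
        refine h3.trans (le_trans (le_of_eq ?_) (hT T le_rfl))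
        ring
    refine mul_le_mul_of_nonneg_left ?_ hq0.le
    have h3 := mul_le_mul_of_nonneg_left h1 (by positivity : 0 ≤ 6 * B₁)
    linarith
  rw [abs_mul, abs_two]
  have := abs_add_le (∑ k ∈ Finset.Ico 1 h, D k * (c k - c (k + 1))) (D h * c h)
  calc _ ≤ 2 * (q * (12 * B₁ + 1) + q / 2) := by gcongr; linarith
    _ = _ := by ring

/-! ### Transfer of approximability from α to p'/q. -/

/-- If `p * p' ≡ 1` modulo `q`, approximability of `p' / q` is controlled by that of `α ≈ p / q`. -/
theorem le_abs_mul_inverse_sub {q : ℕ} (hq : 0 < q) {p p' : ℤ} (hp : (q : ℤ) ∣ p * p' - 1) {α : ℝ}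
    (hα : |α - p / q| ≤ 1 / (q : ℝ) ^ 2) {B : ℝ} (hB : 1 ≤ B) {j : ℕ} (hj1 : 1 ≤ j) (hjq : j < q)
    {i : ℤ} (h : ∀ k : ℤ, 1 ≤ (j * p' - i * q).natAbs →
      1 / (B * (j * p' - i * q).natAbs) ≤ |((j * p' - i * q).natAbs : ℝ) * α - k|) :
    1 / (2 * B * j) ≤ |j * ((p' : ℝ) / q) - i| := by
  have hq0 : (0 : ℝ) < q := by exact_mod_cast hq
  have hj0 : (1 : ℝ) ≤ j := by exact_mod_cast hj1
  set z : ℤ := j * p' - i * q with hz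
  set m : ℕ := z.natAbs with hm
  have hmz : (m : ℝ) = |(z : ℝ)| := by rw [hm, Nat.cast_natAbs, Int.cast_abs]
  have heq : |j * ((p' : ℝ) / q) - i| = m / q := by
    have : j * ((p' : ℝ) / q) - i = z / q := by
      rw [hz]
      push_cast
      field_simp
    rw [this, abs_div, abs_of_pos hq0, hmz]
  -- With z = jp' - iq, zp ≡ j modulo q. So if |z| < q, then zα is within 2j/q of an integer, which
  -- forces |z| to be large.
  obtain ⟨t, ht⟩ : ∃ t : ℤ, z * p = j + q * t := by
    obtain ⟨u, hu⟩ := hp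
    refine ⟨j * u - i * p, ?_⟩
    rw [hz]
    linear_combination (j : ℤ) * hu
  have hm1 : 1 ≤ m := by
    rw [Nat.one_le_iff_ne_zero, hm, Ne, Int.natAbs_eq_zero]
    intro h0
    rw [h0, zero_mul] at ht
    have h1 : (q : ℤ) ∣ j := ⟨-t, by linarith⟩
    have h2 := Nat.le_of_dvd (by omega) (Int.natCast_dvd_natCast.1 h1)
    omega
  have hm0 : (0 : ℝ) < m := by exact_mod_cast hm1
  rw [heq]
  rcases le_or_gt q m with hqm | hqm
  · have h1 : (1 : ℝ) ≤ m / q := by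
      rw [le_div_iff₀ hq0, one_mul]
      exact_mod_cast hqm
    refine le_trans ?_ h1
    rw [div_le_one (by positivity)]
    nlinarith
  · have hmq : (m : ℝ) ≤ q := by exact_mod_cast hqm.le
    have hdist : |(z : ℝ) * α - t| ≤ 2 * j / q := by
      have h1 : (z : ℝ) * α - t = z * (α - p / q) + j / q := by
        have : (z : ℝ) * p = j + q * t := by exact_mod_cast ht
        have h2 : (t : ℝ) = z * (p / q) - j / q := by
          field_simp
          linarith
        rw [h2]
        ring
      rw [h1]
      refine (abs_add_le _ _).trans ?_
      rw [abs_mul, ← hmz, abs_of_nonneg (by positivity : (0 : ℝ) ≤ j / q)]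
      have h3 : m * |α - p / q| ≤ 1 / q := by
        calc m * |α - p / q| ≤ q * (1 / (q : ℝ) ^ 2) := by gcongr
          _ = 1 / q := by field_simp
      have h4 : (1 : ℝ) / q ≤ j / q := by gcongr
      have h5 : 2 * (j : ℝ) / q = j / q + j / q := by ring
      linarith
    have hle : 1 / (B * m) ≤ 2 * j / q := by
      rcases abs_choice (z : ℝ) with hz' | hz'
      · refine (h t hm1).trans ?_
        rwa [hmz, hz']
      · refine (h (-t) hm1).trans ?_
        rw [hmz, hz']
        rwa [← abs_neg, Int.cast_neg, show -(-(z : ℝ) * α - -(t : ℝ)) = z * α - t by ring]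
    rw [div_le_div_iff₀ (by positivity) hq0] at hle ⊢
    linarith

/-- By irrationality the finitely many m below `m₀` only worsen the constant. -/
theorem exists_forall_le_abs_mul_sub {α : ℝ} (hirr : Irrational α) {B₁ : ℝ} {m₀ : ℕ}
    (h : ∀ m : ℕ, 1 ≤ m → m₀ ≤ m → ∀ k : ℤ, 1 / (B₁ * m) ≤ |m * α - k|) (hB₁ : 1 ≤ B₁) :
    ∃ B : ℝ, 1 ≤ B ∧ ∀ m : ℕ, 1 ≤ m → ∀ k : ℤ, 1 / (B * m) ≤ |m * α - k| := by
  suffices hN : ∀ N : ℕ, ∃ B : ℝ, 1 ≤ B ∧ ∀ m : ℕ, 1 ≤ m → m < N → ∀ k : ℤ,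
      1 / (B * m) ≤ |m * α - k| by
    obtain ⟨B, hB, hB'⟩ := hN m₀
    refine ⟨max B B₁, hB.trans (le_max_left _ _), fun m hm k => ?_⟩
    have hm0 : (0 : ℝ) < m := by exact_mod_cast hm
    rcases lt_or_ge m m₀ with h1 | h1
    · refine le_trans ?_ (hB' m hm h1 k)
      gcongr
      exact le_max_left _ _
    · refine le_trans ?_ (h m hm h1 k)
      gcongr
      exact le_max_right _ _
  intro N
  induction N with
  | zero => exact ⟨1, le_rfl, fun m _ hm => absurd hm (Nat.not_lt_zero m)⟩
  | succ N ih =>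
    obtain ⟨B, hB, hB'⟩ := ih
    set ν := |N * α - round (N * α)| with hν
    -- At `N = 0` the quotient is 1/0 = 0, harmless because m ≥ 1.
    refine ⟨max B (1 / (N * ν)), hB.trans (le_max_left _ _), fun m hm hmN k => ?_⟩
    have hm0 : (0 : ℝ) < m := by exact_mod_cast hm
    rcases Nat.lt_succ_iff_lt_or_eq.1 hmN with h1 | rfl
    · refine le_trans ?_ (hB' m hm h1 k)
      gcongr
      exact le_max_left _ _
    · have hν0 : 0 < ν := by
        rw [hν, abs_pos, sub_ne_zero]
        exact (hirr.natCast_mul (by omega)).ne_int _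
      refine le_trans ?_ (round_le (m * α) k)
      rw [← hν, div_le_iff₀ (by positivity)]
      calc (1 : ℝ) = ν * (1 / (m * ν) * m) := by field_simp
        _ ≤ _ := by gcongr; exact le_max_right _ _

theorem exists_forall_log_div_le (C : ℝ) :
    ∃ T : ℕ, 1 ≤ T ∧ ∀ t : ℕ, T ≤ t → C * (Real.log t + 2) / t ≤ 1 := by
  have h1 : Filter.Tendsto (fun x : ℝ => Real.log x / x) Filter.atTop (nhds 0) := by
    simpa using Real.isLittleO_log_id_atTop.tendsto_div_nhds_zero
  have h2 : Filter.Tendsto (fun x : ℝ => C * (Real.log x / x + 2 / x)) Filter.atTop (nhds 0) := by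
    simpa using (h1.add (Filter.Tendsto.div_atTop (tendsto_const_nhds (x := (2 : ℝ)))
      Filter.tendsto_id)).const_mul C
  have h3 := h2.comp (tendsto_natCast_atTop_atTop (R := ℝ))
  obtain ⟨T, hT⟩ := Filter.eventually_atTop.1 (h3.eventually (ge_mem_nhds one_pos))
  refine ⟨max T 1, le_max_right _ _, fun t ht => ?_⟩
  have := hT t ((le_max_left _ _).trans ht)
  simp only [Function.comp_apply] at this
  calc _ = C * (Real.log t / t + 2 / t) := by ring
    _ ≤ 1 := this

/-- The sawtooth sums along the multiples of the inverse of `p` modulo `q`. -/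
theorem abs_sum_range_fract_inverse_le {q : ℕ} (hq : 0 < q) {p p' : ℤ}
    (hp : (q : ℤ) ∣ p * p' - 1) {α : ℝ} (hα : |α - p / q| ≤ 1 / (q : ℝ) ^ 2) {B : ℝ} (hB : 1 ≤ B)
    {N : ℕ} (hNq : N < q)
    (h : ∀ j : ℕ, 1 ≤ j → j ≤ N → ∀ i k : ℤ, 1 ≤ (j * p' - i * q).natAbs →
      1 / (B * (j * p' - i * q).natAbs) ≤ |((j * p' - i * q).natAbs : ℝ) * α - k|) :
    |∑ j ∈ Finset.range N, (Int.fract (((j + 1 : ℕ) : ℝ) * ((p' : ℝ) / q)) - 1 / 2)| ≤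
      6 * (2 * B) * (Real.log N + 1) := by
  -- The offset `y = p' / q` starts the sum at index 1.
  have := abs_sum_range_fract_le (x := (p' : ℝ) / q) (B := 2 * B) (by linarith) N
    (fun j hj hjN i => le_abs_mul_inverse_sub hq hp hα hB hj (by omega) (h j hj hjN i)) (p' / q)
  refine le_trans (le_of_eq ?_) this
  congr 1
  refine Finset.sum_congr rfl fun j _ => ?_
  push_cast
  rw [add_mul, one_mul]

/-! ### Small values of the product at good denominators. -/

theorem abs_sin_pi_mul_le {q : ℕ} (hq : 0 < q) (p : ℤ) (α : ℝ) :
    |Real.sin (Real.pi * q * α)| ≤ Real.pi * (q * |α - p / q|) := by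
  have hq0 : (0 : ℝ) < q := by exact_mod_cast hq
  have h1 : Real.pi * q * α = Real.pi * (q * (α - p / q)) + p * Real.pi := by
    field_simp
    ring
  have h2 : |((-1 : ℝ) ^ p)| = 1 := by rw [abs_zpow]; simp
  rw [h1, Real.sin_add_int_mul_pi, abs_mul, h2, one_mul]
  refine Real.abs_sin_le_abs.trans (le_of_eq ?_)
  rw [abs_mul, abs_mul, abs_of_pos Real.pi_pos, abs_of_pos hq0]

/-- If `α` is badly approximable with asymptotic constant `L + 2` for a large `L`, the Sudler
product is small at the denominators of fractions approximating `α` to within `1 / (L q ^ 2)`. -/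
theorem exists_forall_sudlerProduct_le_half {α : ℝ} (hirr : Irrational α) {L : ℝ}
    (hL : Real.exp 802 ≤ L) {m₀ : ℕ}
    (h : ∀ m : ℕ, 1 ≤ m → m₀ ≤ m → ∀ k : ℤ, 1 / ((L + 2) * m) ≤ |m * α - k|) :
    ∃ Q : ℕ, ∀ q : ℕ, Q ≤ q → ∀ p : ℤ, IsCoprime p q → |α - p / q| ≤ 1 / (L * (q : ℝ) ^ 2) →
      sudlerProduct q α ≤ 1 / 2 := by
  have hL1 : 1 ≤ L := (Real.one_le_exp (by norm_num)).trans hL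
  have hL0 : 0 < L := by linarith
  obtain ⟨B, hB, hBall⟩ := exists_forall_le_abs_mul_sub hirr h (by linarith)
  obtain ⟨T, hT1, hT⟩ := exists_forall_log_div_le (6 * (2 * B))
  -- For j ≤ T, the crude constant `B` gives |jp' - iq| ≥ q/(2BT) ≥ m₀, so the sharp constant L + 2
  -- becomes available.
  obtain ⟨Q, hQ⟩ := exists_nat_ge (2 * B * T * m₀)
  refine ⟨max Q (2 * T + 1), fun q hqQ p hpq hαL => ?_⟩
  have hQq : Q ≤ q := (le_max_left _ _).trans hqQ
  have hTq : 2 * T < q := (le_max_right _ _).trans hqQ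
  have hq : 0 < q := by omega
  have hq0 : (0 : ℝ) < q := by exact_mod_cast hq
  have hT0 : (0 : ℝ) < T := by exact_mod_cast hT1
  have hα : |α - p / q| ≤ 1 / (q : ℝ) ^ 2 :=
    hαL.trans (one_div_le_one_div_of_le (by positivity) (le_mul_of_one_le_left (sq_nonneg _) hL1))
  obtain ⟨p', t, hp't⟩ := hpq
  have hp : (q : ℤ) ∣ p * p' - 1 := ⟨-t, by linarith⟩
  have hcop' : IsCoprime p' (q : ℤ) := ⟨p, t, by linarith⟩
  have hD₂ : ∀ k : ℕ, k < q → |∑ j ∈ Finset.range k,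
      (Int.fract (((j + 1 : ℕ) : ℝ) * ((p' : ℝ) / q)) - 1 / 2)| ≤
        6 * (2 * B) * (Real.log k + 1) := fun k hk =>
    abs_sum_range_fract_inverse_le hq hp hα hB hk fun j _ _ i l hm => hBall _ hm l
  have hD₁ : ∀ k : ℕ, k ≤ T → |∑ j ∈ Finset.range k,
      (Int.fract (((j + 1 : ℕ) : ℝ) * ((p' : ℝ) / q)) - 1 / 2)| ≤
        6 * (2 * (L + 2)) * (Real.log k + 1) := by
    refine fun k hk => abs_sum_range_fract_inverse_le hq hp hα (by linarith) (by omega)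
      fun j hj1 hjk i l hm => h _ hm ?_ l
    have h1 := le_abs_mul_inverse_sub hq hp hα hB hj1 (by omega) (i := i)
      fun l hm => hBall _ hm l
    have h2 : |j * ((p' : ℝ) / q) - i| = ((j * p' - i * q).natAbs : ℝ) / q := by
      have : j * ((p' : ℝ) / q) - i = ((j * p' - i * q : ℤ) : ℝ) / q := by
        push_cast
        field_simp
      rw [this, abs_div, abs_of_pos hq0, Nat.cast_natAbs, Int.cast_abs]
    have hj0 : (0 : ℝ) < j := by exact_mod_cast hj1
    have hjT : (j : ℝ) ≤ T := by exact_mod_cast hjk.trans hk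
    rw [h2, div_le_div_iff₀ (by positivity) hq0, one_mul] at h1
    have h3 : (2 * B * T) * (m₀ : ℝ) ≤ (2 * B * T) * ((j * p' - i * q).natAbs : ℝ) := by
      calc _ ≤ (Q : ℝ) := hQ
        _ ≤ q := by exact_mod_cast hQq
        _ ≤ _ := h1
        _ ≤ (2 * B * T) * ((j * p' - i * q).natAbs : ℝ) := by
          rw [mul_comm]
          gcongr
    exact_mod_cast le_of_mul_le_mul_left h3 (by positivity)
  have hcot := abs_sum_mul_cot_le hcop' (by linarith) (by linarith) hT1 hT hTq hD₁ hD₂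
  have hprod := prod_abs_two_mul_sin_le hq ⟨p', t, hp't⟩ hα
  rw [sum_mul_cot_eq hq hp] at hprod
  set S := ∑ k ∈ Finset.Ico 1 q, Int.fract (k * ((p' : ℝ) / q)) * Real.cot (Real.pi * k / q)
  -- The factor L + 2 from the sawtooth bound cancels the 1/L in |α - p/q|.
  have hE : Real.pi * (α - p / q) * (q * S) ≤ 600 := by
    refine (le_abs_self _).trans ?_
    rw [abs_mul, abs_mul, abs_mul, abs_of_pos Real.pi_pos, abs_of_pos hq0]
    calc _ ≤ 4 * (1 / (L * (q : ℝ) ^ 2)) * (q * (q * (24 * (2 * (L + 2)) + 3))) := by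
          gcongr
          exact Real.pi_le_four
      _ = 4 * (48 + 99 / L) := by field_simp; ring
      _ ≤ 4 * (48 + 99 / 1) := by gcongr
      _ ≤ 600 := by norm_num
  have hlast := abs_sin_pi_mul_le hq p α
  have hsplit : sudlerProduct q α =
      (∏ r ∈ Finset.Ico 1 q, |2 * Real.sin (Real.pi * r * α)|) *
        |2 * Real.sin (Real.pi * q * α)| := by
    rw [sudlerProduct, ← Finset.Ico_add_one_right_eq_Icc, Finset.prod_Ico_succ_top (by omega)]
  have hexp : 16 * Real.exp 600 ≤ L := by
    have h1 : (16 : ℝ) ≤ Real.exp 202 := by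
      have := Real.add_one_le_exp (202 : ℝ)
      linarith
    have h2 : Real.exp 802 = Real.exp 202 * Real.exp 600 := by
      rw [← Real.exp_add]
      norm_num
    rw [h2] at hL
    exact (mul_le_mul_of_nonneg_right h1 (Real.exp_pos _).le).trans hL
  rw [hsplit]
  calc _ ≤ (q * Real.exp 600) * (2 * (4 * (q * (1 / (L * (q : ℝ) ^ 2))))) := by
        gcongr
        · exact hprod.trans (by gcongr)
        · rw [abs_mul, abs_two]
          gcongr
          refine hlast.trans ?_
          gcongr
          exact Real.pi_le_four
    _ = 8 * Real.exp 600 / L := by field_simp; norm_num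
    _ ≤ 1 / 2 := by
        rw [div_le_div_iff₀ hL0 two_pos]
        linarith

/-! ### From small values to a vanishing lower limit. -/

theorem sudlerProduct_nonneg (n : ℕ) (α : ℝ) : 0 ≤ sudlerProduct n α :=
  Finset.prod_nonneg fun _ _ => abs_nonneg _

theorem sudlerProduct_pos {α : ℝ} (hirr : Irrational α) (n : ℕ) : 0 < sudlerProduct n α := by
  refine Finset.prod_pos fun r hr => abs_pos.2 (mul_ne_zero two_ne_zero ?_)
  rw [Finset.mem_Icc] at hr
  rw [Real.sin_ne_zero_iff]
  intro k hk
  have h1 : (r : ℝ) * α = k := by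
    have := Real.pi_ne_zero
    apply mul_left_cancel₀ this
    linarith
  exact (hirr.natCast_mul (by omega)).ne_int k h1

/-- The factors beyond the q-th are those of P_n shifted by π(qα - p), since |sin| has period π. -/
theorem sudlerProduct_add (n q : ℕ) (p : ℤ) (α : ℝ) :
    sudlerProduct (n + q) α = sudlerProduct q α *
      ∏ r ∈ Finset.Icc 1 n, |2 * Real.sin (Real.pi * r * α + Real.pi * (q * α - p))| := by
  have h2 : |((-1 : ℝ) ^ p)| = 1 := by rw [abs_zpow]; simp
  induction n with
  | zero => simp
  | succ n ih =>
    rw [Finset.prod_Icc_succ_top (by omega), ← mul_assoc, ← ih, sudlerProduct,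
      (by omega : n + 1 + q = n + q + 1), Finset.prod_Icc_succ_top (by omega), sudlerProduct]
    congr 1
    have : Real.pi * ((n + q + 1 : ℕ) : ℝ) * α =
        Real.pi * ((n + 1 : ℕ) : ℝ) * α + Real.pi * (q * α - p) + p * Real.pi := by
      push_cast
      ring
    rw [this, Real.sin_add_int_mul_pi, abs_mul, abs_mul, abs_mul, h2, one_mul]

/-- If the Sudler product is at most `1 / 2` at arbitrarily large denominators of good rational
approximations, then its lower limit vanishes. -/
theorem liminf_sudlerProduct_eq_zero {α : ℝ} (hirr : Irrational α)
    (h : ∀ Q : ℕ, ∃ q : ℕ, Q ≤ q ∧ sudlerProduct q α ≤ 1 / 2 ∧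
      ∃ p : ℤ, |q * α - p| ≤ 1 / q) :
    Filter.liminf (fun n : ℕ => (sudlerProduct n α : EReal)) Filter.atTop = 0 := by
  -- For fixed n the shifted product is continuous in the shift, so a large q costs at most a factor
  -- 3/2 against the gain 1/2.
  have hstep : ∀ n : ℕ, ∃ N, n < N ∧ sudlerProduct N α ≤ 3 / 4 * sudlerProduct n α := by
    intro n
    have hpos := sudlerProduct_pos hirr n
    have hcont : Continuous fun ε : ℝ =>
        ∏ r ∈ Finset.Icc 1 n, |2 * Real.sin (Real.pi * r * α + Real.pi * ε)| := by
      fun_prop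
    have h0 : (∏ r ∈ Finset.Icc 1 n, |2 * Real.sin (Real.pi * r * α + Real.pi * 0)|) <
        3 / 2 * sudlerProduct n α := by
      simp only [mul_zero, add_zero]
      change sudlerProduct n α < _
      linarith
    obtain ⟨η, hη, hη'⟩ := Metric.eventually_nhds_iff.1
      (hcont.continuousAt.eventually (gt_mem_nhds h0))
    obtain ⟨Q, hQ⟩ := exists_nat_gt (1 / η)
    obtain ⟨q, hq, hhalf, p, hp⟩ := h (Q + 1)
    have hq0 : (0 : ℝ) < q := by exact_mod_cast (by omega : 0 < q)
    refine ⟨n + q, by omega, ?_⟩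
    have h1 : |q * α - p| < η := by
      refine hp.trans_lt ?_
      rw [div_lt_comm₀ hq0 hη]
      exact hQ.trans_le (by exact_mod_cast (by omega : Q ≤ q))
    have h2 := hη' (y := q * α - p) (by rwa [Real.dist_eq, sub_zero])
    rw [sudlerProduct_add n q p α]
    calc _ ≤ 1 / 2 * (3 / 2 * sudlerProduct n α) :=
          mul_le_mul hhalf h2.le (Finset.prod_nonneg fun _ _ => abs_nonneg _) (by norm_num)
      _ = _ := by ring
  have hiter : ∀ k : ℕ, ∃ N, k ≤ N ∧ sudlerProduct N α ≤ (3 / 4) ^ k := by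
    intro k
    induction k with
    | zero => exact ⟨0, le_rfl, by simp [sudlerProduct]⟩
    | succ k ih =>
      obtain ⟨N, hN, hN'⟩ := ih
      obtain ⟨N', hN1, hN2⟩ := hstep N
      refine ⟨N', by omega, hN2.trans ?_⟩
      rw [pow_succ, mul_comm]
      gcongr
  apply le_antisymm
  · refine EReal.le_of_forall_lt_iff_le.1 fun ε hε => ?_
    have hε0 : 0 < ε := by exact_mod_cast hε
    refine Filter.liminf_le_of_frequently_le' (Filter.frequently_atTop.2 fun n => ?_)
    obtain ⟨k₀, hk₀⟩ := exists_pow_lt_of_lt_one hε0 (by norm_num : (3 / 4 : ℝ) < 1)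
    obtain ⟨N, hN, hN'⟩ := hiter (max n k₀)
    refine ⟨N, (le_max_left _ _).trans hN, ?_⟩
    have : ((3 / 4 : ℝ)) ^ (max n k₀) ≤ (3 / 4) ^ k₀ :=
      pow_le_pow_of_le_one (by norm_num) (by norm_num) (le_max_right _ _)
    exact_mod_cast (hN'.trans this).trans hk₀.le
  · refine Filter.le_liminf_of_le (by isBoundedDefault) (Filter.Eventually.of_forall fun n => ?_)
    exact_mod_cast sudlerProduct_nonneg n α

/-- A bounded sequence of partial quotients exceeding `e ^ 802` infinitely often forces the lower
limit of the Sudler products to vanish. -/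
theorem HasContFracCoeffs.liminf_sudlerProduct_eq_zero {α : ℝ} {a : ℕ → ℕ}
    (h : HasContFracCoeffs α a) {M K : ℕ} (hM : ∀ j, 1 ≤ j → a j ≤ M)
    (hfreq : ∃ᶠ j in Filter.atTop, K ≤ a j) (hK : Real.exp 802 ≤ K) :
    Filter.liminf (fun n : ℕ => (sudlerProduct n α : EReal)) Filter.atTop = 0 := by
  classical
  have hKM : K ≤ M := by
    obtain ⟨j, hj, hKj⟩ := Filter.frequently_atTop.1 hfreq 1
    exact hKj.trans (hM j hj)
  -- the upper limit of the partial quotients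
  set L := Nat.findGreatest (fun v => ∃ᶠ j in Filter.atTop, v ≤ a j) M with hLdef
  have hLfreq : ∃ᶠ j in Filter.atTop, L ≤ a j :=
    Nat.findGreatest_spec (P := fun v => ∃ᶠ j in Filter.atTop, v ≤ a j) hKM hfreq
  have hKL : K ≤ L := Nat.le_findGreatest hKM hfreq
  have hev : ∀ᶠ j in Filter.atTop, a j ≤ L := by
    rcases lt_or_ge L M with hLM | hLM
    · have := Nat.findGreatest_is_greatest (P := fun v => ∃ᶠ j in Filter.atTop, v ≤ a j)
        (Nat.lt_succ_self L) hLM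
      rw [Filter.not_frequently] at this
      filter_upwards [this] with j hj
      omega
    · filter_upwards [Filter.eventually_ge_atTop 1] with j hj
      exact (hM j hj).trans hLM
  have hLexp : Real.exp 802 ≤ L := hK.trans (by exact_mod_cast hKL)
  have hL1 : (1 : ℝ) ≤ L := (Real.one_le_exp (by norm_num)).trans hLexp
  obtain ⟨m₀, hm₀⟩ := h.exists_le_abs_mul_sub hev
  obtain ⟨Q₀, hQ₀⟩ := exists_forall_sudlerProduct_le_half h.irrational hLexp hm₀
  refine _root_.liminf_sudlerProduct_eq_zero h.irrational fun Q => ?_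
  obtain ⟨r, hrQ, hr⟩ := h.exists_rat_abs_sub_le (by exact_mod_cast hL1) hLfreq (max Q Q₀)
  have hd : (0 : ℝ) < r.den := by exact_mod_cast r.den_pos
  have hrr : (r : ℝ) = r.num / r.den := Rat.cast_def r
  rw [hrr] at hr
  refine ⟨r.den, (le_max_left _ _).trans hrQ,
    hQ₀ r.den ((le_max_right _ _).trans hrQ) r.num (Rat.isCoprime_num_den r) hr, r.num, ?_⟩
  have h1 : r.den * α - r.num = r.den * (α - r.num / r.den) := by field_simp
  rw [h1, abs_mul, Nat.abs_cast]
  calc (r.den : ℝ) * |α - r.num / r.den| ≤ r.den * (1 / (1 * (r.den : ℝ) ^ 2)) := by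
        gcongr
        exact hr.trans (by gcongr)
    _ = 1 / r.den := by field_simp

theorem theorem5p1 :
    (∃ M₀ : ℕ, ∀ M : ℕ, M₀ ≤ M → ∃ K : ℕ, 1 ≤ K ∧ K ≤ M ∧
      ∀ (α : ℝ) (a : ℕ → ℕ), HasContFracCoeffs α a → IsGreatest (a '' Set.Ici 1) M →
        (∃ᶠ j in Filter.atTop, K ≤ a j) →
          Filter.liminf (fun n : ℕ => (sudlerProduct n α : EReal)) Filter.atTop = 0) ∧
    (∀ M K : ℕ, 1 ≤ K → K ≤ M →
      802 + 151 * Real.log (M : ℝ) / (K : ℝ) - Real.log (K : ℝ) < 0 →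
        ∀ (α : ℝ) (a : ℕ → ℕ), HasContFracCoeffs α a → IsGreatest (a '' Set.Ici 1) M →
          (∃ᶠ j in Filter.atTop, K ≤ a j) →
            Filter.liminf (fun n : ℕ => (sudlerProduct n α : EReal)) Filter.atTop = 0) := by
  constructor
  · obtain ⟨M₀, hM₀⟩ := exists_nat_ge (Real.exp 802)
    have hM₀1 : 1 ≤ M₀ := by
      exact_mod_cast (Real.one_le_exp (by norm_num : (0 : ℝ) ≤ 802)).trans hM₀
    exact ⟨M₀, fun M hM => ⟨M₀, hM₀1, hM, fun α a h hmax hfreq =>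
      h.liminf_sudlerProduct_eq_zero (fun j hj => hmax.2 ⟨j, hj, rfl⟩) hfreq hM₀⟩⟩
  · intro M K hK hKM hlt α a h hmax hfreq
    refine h.liminf_sudlerProduct_eq_zero (fun j hj => hmax.2 ⟨j, hj, rfl⟩) hfreq ?_
    have hK0 : (0 : ℝ) < K := by exact_mod_cast hK
    -- This term is nonnegative, so the hypothesis already forces log K > 802.
    have h1 : 0 ≤ 151 * Real.log (M : ℝ) / K := by
      have := Real.log_natCast_nonneg M
      positivity
    rw [← Real.le_log_iff_exp_le hK0]
    linarith
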